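/- Conventions. Let $V$ be a Euclidean space. A function $u$ on an open set $X\subseteq V$ is *subharmonic* on $X$ if it is upper semicontinuous with values in $[-\infty,\infty)$ and, for every compact $K\subseteq X$ and every real function $h$ that is continuous on $K$, harmonic in the interior of $K$ and satisfies $u\le h$ on $\partial K$, one has $u\le h$ on $K$ (the function $u\equiv-\infty$ is allowed). A function $u$ on an open set $X\subseteq\mathbb C^n$ is *plurisubharmonic* on $X$ if it is upper semicontinuous with values in $[-\infty,\infty)$ and for all $a,w\in\mathbb C^n$ the function $\tau\mapsto u(a+\tau w)$ is subharmonic on the open set $\{\tau\in\mathbb C: a+\tau w\in X\}$. In $\mathbb C^n\cong\mathbb R^{2n}$ subharmonicity, Lebesgue measure and Hausdorff measure refer to the standard Euclidean structure. **Theorem.** Let $\Omega\subseteq\mathbb C^n$ be a domain (a non-empty connected open set) and let $E\subseteq\Omega$ be closed in $\Omega$. 1. If $E$ has Lebesgue measure zero, then every function $u$ that is subharmonic on $\Omega$ and plurisubharmonic on $\Omega\setminus E$ is plurisubharmonic on all of $\Omega$. 2. (Chirka's conjecture.) In particular, the same conclusion holds if $E$ has locally finite $(2n-1)$-dimensional Hausdorff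 measure in $\Omega$, that is, if every $z\in\Omega$ has a neighbourhood $U$ with $\mathcal H^{2n-1}(E\cap U)<\infty$. -/

import Mathlib

open MeasureTheory Topology
open scoped ENNReal

/-- An extended-real-valued function `u` is subharmonic on the open set `s` of a Euclidean space:
it is upper semicontinuous on `s` with values in `[-∞, ∞)`, and for every compact `K ⊆ s` and every
real function `h` that is continuous on `K`, harmonic in the interior of `K` and at least `u` on the
boundary of `K`, one has `u ≤ h` on all of `K`. The function that is constantly `-∞` is allowed. -/
structure IsSubharmonicOn {V : Type*} [NormedAddCommGroup V] [InnerProductSpace ℝ V]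
    [FiniteDimensional ℝ V] (u : V → EReal) (s : Set V) : Prop where
  lt_top : ∀ x ∈ s, u x < ⊤
  upperSemicontinuousOn : UpperSemicontinuousOn u s
  le_of_harmonic : ∀ K : Set V, IsCompact K → K ⊆ s → ∀ h : V → ℝ, ContinuousOn h K →
    InnerProductSpace.HarmonicOnNhd h (interior K) →
    (∀ x ∈ frontier K, u x ≤ (h x : EReal)) → ∀ x ∈ K, u x ≤ (h x : EReal)

/-- `u` is plurisubharmonic on the open set `s ⊆ ℂⁿ`: it is upper semicontinuous on `s` with values
in `[-∞, ∞)`, and its restriction to every complex line `τ ↦ a + τ w` is subharmonic on the open set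
of those `τ ∈ ℂ` for which `a + τ w` lies in `s`. -/
structure IsPlurisubharmonicOn {n : ℕ} (u : EuclideanSpace ℂ (Fin n) → EReal)
    (s : Set (EuclideanSpace ℂ (Fin n))) : Prop where
  lt_top : ∀ z ∈ s, u z < ⊤
  upperSemicontinuousOn : UpperSemicontinuousOn u s
  subharmonicOn_line : ∀ a w : EuclideanSpace ℂ (Fin n),
    IsSubharmonicOn (fun τ : ℂ => u (a + τ • w)) {τ : ℂ | a + τ • w ∈ s}

/-! Suppose the maximum principle fails on a complex line. Then an affine perturbation of the
harmonic majorant, minus a multiple of `‖τ - τ₁‖ ^ 2`, touches `u` strictly from above along the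
line at `τ₁`. A large multiple of the squared transversal part extends it to a `C²` function `φ`
touching `u` on a full ball in `ℂⁿ`, with a strict gap away from the centre.

The contact point may lie in `E`, so `φ` is tilted by small linear forms `⟪p, ·⟫`, in the spirit of
Jensen's lemma for viscosity solutions. Each tilt has a contact point `x p`. Subharmonicity in all
real directions makes `x p ↦ p` well defined and Lipschitz (`IsSubharmonicOn.norm_slope_sub_le`): if
`u` lay below two paraboloids of very different slopes, an explicit harmonic barrier would push `u`
below its contact value. The contact points therefore have positive measure, and one of them is
outside `E` (`IsSubharmonicOn.exists_touching_notMem`). On the parallel line through it the penalty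
is constant, so `u` is touched by a strictly superharmonic function where it is already
plurisubharmonic, a contradiction. -/

/-! ### Harmonicity of affine functions and trace-free quadratics. -/

theorem hasFDerivAt_bilinear_sub {V : Type*} [NormedAddCommGroup V] [InnerProductSpace ℝ V]
    (B : V →L[ℝ] V →L[ℝ] ℝ) (c z : V) :
    HasFDerivAt (fun z => B (z - c) (z - c)) ((B + B.flip) (z - c)) z := by
  have h1 : HasFDerivAt (fun z : V => z - c) (ContinuousLinearMap.id ℝ V) z :=
    (hasFDerivAt_id z).sub_const c
  have h2 := (B.hasFDerivAt_of_bilinear h1 h1)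
  refine h2.congr_fderiv ?_
  ext v
  simp [ContinuousLinearMap.precompR, ContinuousLinearMap.precompL]

section Harmonic

variable {V : Type*} [NormedAddCommGroup V] [InnerProductSpace ℝ V] [FiniteDimensional ℝ V]

/-- A quadratic form of trace zero is harmonic. -/
theorem harmonicAt_bilinear {ι : Type*} [Fintype ι] (b : OrthonormalBasis ι ℝ V)
    (B : V →L[ℝ] V →L[ℝ] ℝ) (hB : ∑ i, B (b i) (b i) = 0) (c x : V) :
    InnerProductSpace.HarmonicAt (fun z => B (z - c) (z - c)) x := by
  constructor
  · fun_prop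
  · refine Filter.Eventually.of_forall fun y => ?_
    rw [InnerProductSpace.laplacian_eq_iteratedFDeriv_orthonormalBasis _ b]
    have h1 : fderiv ℝ (fun z => B (z - c) (z - c)) = fun z => (B + B.flip) (z - c) :=
      funext fun z => (hasFDerivAt_bilinear_sub B c z).fderiv
    have h2 : fderiv ℝ (fderiv ℝ (fun z => B (z - c) (z - c))) y = B + B.flip := by
      rw [h1]
      exact ((B + B.flip).hasFDerivAt.comp y ((hasFDerivAt_id y).sub_const c)).fderiv
    simp only [iteratedFDeriv_two_apply, h2]
    simp [Finset.sum_add_distrib, hB]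

theorem harmonicAt_continuousLinearMap (L : V →L[ℝ] ℝ) (x : V) :
    InnerProductSpace.HarmonicAt (fun z => L z) x := by
  constructor
  · fun_prop
  · refine Filter.Eventually.of_forall fun y => ?_
    rw [InnerProductSpace.laplacian_eq_iteratedFDeriv_stdOrthonormalBasis]
    have h1 : fderiv ℝ (fun z => L z) = fun _ => L := funext fun z => L.fderiv
    simp [iteratedFDeriv_two_apply, h1]

theorem harmonicAt_affine (c : ℝ) (L : V →L[ℝ] ℝ) (x₀ x : V) :
    InnerProductSpace.HarmonicAt (fun z => c + L (z - x₀)) x := by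
  have h := (InnerProductSpace.harmonicAt_const (c - L x₀) (x := x)).add
    (harmonicAt_continuousLinearMap L x)
  convert h using 1
  ext z
  simp only [map_sub, Pi.add_apply]
  ring

end Harmonic

/-! ### Touching upper semicontinuous functions from above. -/

section Semicontinuous

theorem UpperSemicontinuousOn.add_coe {X : Type*} [TopologicalSpace X] {u : X → EReal}
    {K : Set X} (hu : UpperSemicontinuousOn u K) {ψ : X → ℝ} (hψ : ContinuousOn ψ K) :
    UpperSemicontinuousOn (fun z => u z + (ψ z : EReal)) K := by
  refine hu.add' ?_ fun x _ => ?_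
  · exact (continuous_coe_real_ereal.comp_continuousOn hψ).upperSemicontinuousOn
  · exact EReal.continuousAt_add (Or.inr (EReal.coe_ne_bot _)) (Or.inr (EReal.coe_ne_top _))

/-- On a compact set an upper semicontinuous function is touched from above by a translate of any
given continuous function. -/
theorem UpperSemicontinuousOn.exists_touching {X : Type*} [TopologicalSpace X] {u : X → EReal}
    {K : Set X} (hK : IsCompact K) (hu : UpperSemicontinuousOn u K) (hlt : ∀ z ∈ K, u z < ⊤)
    {ψ : X → ℝ} (hψ : ContinuousOn ψ K) {z₁ : X} (hz₁ : z₁ ∈ K) (hbot : u z₁ ≠ ⊥) :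
    ∃ x ∈ K, ∃ a : ℝ, u x = (a : EReal) ∧ ∀ z ∈ K, u z ≤ ((a + (ψ z - ψ x) : ℝ) : EReal) := by
  obtain ⟨x, hxK, hx⟩ := UpperSemicontinuousOn.exists_isMaxOn ⟨z₁, hz₁⟩ hK (hu.add_coe hψ.neg)
  have hxb : u x ≠ ⊥ := by
    intro h
    have h1 : u z₁ + ((-ψ z₁ : ℝ) : EReal) ≤ u x + ((-ψ x : ℝ) : EReal) := hx hz₁
    rw [h, EReal.bot_add, le_bot_iff, EReal.add_eq_bot_iff] at h1
    rcases h1 with h1 | h1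
    · exact hbot h1
    · exact EReal.coe_ne_bot _ h1
  have hxa : u x = ((u x).toReal : EReal) := (EReal.coe_toReal (hlt x hxK).ne hxb).symm
  refine ⟨x, hxK, (u x).toReal, hxa, fun z hz => ?_⟩
  have h1 : u z + ((-ψ z : ℝ) : EReal) ≤ u x + ((-ψ x : ℝ) : EReal) := hx hz
  rw [hxa] at h1
  by_cases hzb : u z = ⊥
  · rw [hzb]; exact bot_le
  · rw [← EReal.coe_toReal (hlt z hz).ne hzb] at h1 ⊢
    norm_cast at h1 ⊢
    linarith

end Semicontinuous

/-! ### Quadratic error of tangents. -/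

section Compact

variable {V : Type*} [NormedAddCommGroup V] [NormedSpace ℝ V]

/-- A function of class `C²` near a compact convex set lies below its tangents up to a uniform
quadratic error. -/
theorem ContDiffOn.exists_le_tangent_add_sq {φ : V → ℝ} {U K : Set V} (hU : IsOpen U)
    (hφ : ContDiffOn ℝ 2 φ U) (hKU : K ⊆ U) (hK : IsCompact K) (hKc : Convex ℝ K) :
    ∃ C : ℝ, 0 ≤ C ∧ ∀ x ∈ K, ∀ z ∈ K,
      φ z ≤ φ x + fderiv ℝ φ x (z - x) + C * ‖z - x‖ ^ 2 := by
  have h1 : ContDiffOn ℝ 1 (fderiv ℝ φ) U := hφ.fderiv_of_isOpen hU (by norm_num)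
  obtain ⟨C, hC⟩ := (h1.mono hKU).exists_lipschitzOnWith one_ne_zero hKc hK
  refine ⟨C, C.2, fun x hx z hz => ?_⟩
  have hd : ∀ y ∈ U, HasFDerivAt φ (fderiv ℝ φ y) y := fun y hy =>
    ((hφ.contDiffAt (hU.mem_nhds hy)).differentiableAt (by norm_num)).hasFDerivAt
  have hseg : segment ℝ x z ⊆ K := hKc.segment_subset hx hz
  have h2 := (convex_segment x z).norm_image_sub_le_of_norm_hasFDerivWithin_le' (f := φ)
    (f' := fderiv ℝ φ) (φ := fderiv ℝ φ x) (C := C * ‖z - x‖)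
    (fun y hy => (hd y (hKU (hseg hy))).hasFDerivWithinAt)
    (fun y hy => by
      have h3 := hC.dist_le_mul y (hseg hy) x hx
      rw [dist_eq_norm, dist_eq_norm] at h3
      exact h3.trans (mul_le_mul_of_nonneg_left (norm_sub_le_of_mem_segment hy) C.2))
    (left_mem_segment ℝ x z) (right_mem_segment ℝ x z)
  have h3 := (abs_le.1 (Real.norm_eq_abs _ ▸ h2)).2
  nlinarith

end Compact

/-! ### Harmonic barrier and the slope estimate. -/

section Touching

variable {V : Type*} [NormedAddCommGroup V] [InnerProductSpace ℝ V] [FiniteDimensional ℝ V]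
  {u : V → EReal} {Ω : Set V}

theorem harmonicAt_sq_inner_sub_sq_norm {e : V} (he : ‖e‖ = 1) (κ : ℝ) (x z : V) :
    InnerProductSpace.HarmonicAt (fun z =>
      κ * (Module.finrank ℝ V * inner ℝ e (z - x) ^ 2 - ‖z - x‖ ^ 2)) z := by
  obtain ⟨B, hB⟩ : ∃ B : V →L[ℝ] V →L[ℝ] ℝ, ∀ z : V,
      B z z = κ * (Module.finrank ℝ V * inner ℝ e z ^ 2 - ‖z‖ ^ 2) := by
    refine ⟨κ • ((Module.finrank ℝ V : ℝ) • (innerSL ℝ e).smulRight (innerSL ℝ e) -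
      (isBoundedBilinearMap_inner (𝕜 := ℝ) (E := V)).toContinuousLinearMap), fun z => ?_⟩
    simp [sq]
  simp only [← hB]
  refine harmonicAt_bilinear (stdOrthonormalBasis ℝ V) B ?_ x z
  simp only [hB, ← Finset.mul_sum, Finset.sum_sub_distrib, OrthonormalBasis.norm_eq_one,
    OrthonormalBasis.sum_sq_inner_left, he]
  simp

/-- An explicit harmonic quadratic polynomial which on a sphere lies below the positive part of an
affine function, yet is positive at the centre. -/
theorem exists_harmonic_barrier (hN : 0 < Module.finrank ℝ V) {e : V} (he : ‖e‖ = 1) {R : ℝ}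
    (hR : 0 < R) (x : V) :
    ∃ k : V → ℝ, Continuous k ∧ (∀ z, InnerProductSpace.HarmonicAt k z) ∧
      k x = R / (16 * Module.finrank ℝ V) ∧
      ∀ r : ℝ, 4 * (Module.finrank ℝ V : ℝ) * r ≤ 3 * R → ∀ z, ‖z - x‖ = R →
        k z ≤ 0 ∨ k z ≤ inner ℝ e (z - x) - r := by
  have hN1 : (1 : ℝ) ≤ Module.finrank ℝ V := by exact_mod_cast hN
  have hharm := fun (κ : ℝ) (z : V) => harmonicAt_sq_inner_sub_sq_norm he κ x z
  generalize (Module.finrank ℝ V : ℝ) = N at hN1 hharm ⊢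
  have hN0 : 0 < N := by linarith
  -- With `t = ⟪e, z - x⟫`, the restriction to the sphere factors as `(t + R) (4Nt - 3R) / (16NR)`,
  -- changing sign at `t = 3R / (4N)`. The missing `-‖z - x‖ ^ 2` lifts the centre to `R / (16N)`.
  refine ⟨fun z => (R / (16 * N) + (((4 * N - 3) / (16 * N)) • innerSL ℝ e) (z - x)) +
    1 / (4 * N * R) * (N * inner ℝ e (z - x) ^ 2 - ‖z - x‖ ^ 2), by fun_prop,
    fun z => (harmonicAt_affine _ _ x z).add (hharm _ z), by simp, ?_⟩
  intro r hr z hz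
  have htR : |inner ℝ e (z - x)| ≤ R := by
    have := abs_real_inner_le_norm e (z - x)
    rwa [he, hz, one_mul] at this
  simp only [_root_.smul_apply, innerSL_apply_apply, smul_eq_mul, hz]
  generalize (inner ℝ e (z - x) : ℝ) = t at htR ⊢
  have ht := abs_le.1 htR
  have hval : R / (16 * N) + (4 * N - 3) / (16 * N) * t + 1 / (4 * N * R) * (N * t ^ 2 - R ^ 2) =
      (t + R) * (4 * N * t - 3 * R) / (16 * N * R) := by
    field_simp
    ring
  rw [hval]
  rcases le_total (4 * N * t) (3 * R) with hle | hle
  · exact Or.inl (div_nonpos_of_nonpos_of_nonneg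
      (mul_nonpos_of_nonneg_of_nonpos (by linarith) (by linarith)) (by positivity))
  · refine Or.inr ?_
    rw [div_le_iff₀ (by positivity)]
    have h5 : (t + R) * (4 * N * t - 3 * R) ≤ (2 * R) * (4 * N * t - 3 * R) :=
      mul_le_mul_of_nonneg_right (by linarith) (by linarith)
    have h6 : R * (4 * N * r) ≤ R * (3 * R) := mul_le_mul_of_nonneg_left hr hR.le
    have h7 : R * (3 * R) ≤ R * (4 * N * t) := mul_le_mul_of_nonneg_left hle hR.le
    linarith

/-- If a subharmonic function lies below two paraboloids whose slopes differ by `v`, the first of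
them touching at `x`, then `v` is controlled by the size of the ball. -/
theorem IsSubharmonicOn.norm_slope_le (hu : IsSubharmonicOn u Ω) (hN : 0 < Module.finrank ℝ V)
    {x y v : V} {a C R : ℝ} (L : V →L[ℝ] ℝ) (hC : 0 ≤ C) (hR : 0 < R)
    (hyR : 4 * (Module.finrank ℝ V : ℝ) * ‖y - x‖ ≤ 3 * R)
    (hΩ : Metric.closedBall x R ⊆ Ω) (hx : u x = (a : EReal))
    (h₁ : ∀ z ∈ Metric.closedBall x R,
      u z ≤ ((a + L (z - x) + C * ‖z - x‖ ^ 2 : ℝ) : EReal))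
    (h₂ : ∀ z ∈ Metric.closedBall x R,
      u z ≤ ((a + L (z - x) + C * ‖z - x‖ ^ 2 + inner ℝ v (z - y) : ℝ) : EReal)) :
    ‖v‖ ≤ 16 * Module.finrank ℝ V * C * R := by
  rcases eq_or_ne v 0 with rfl | hv
  · rw [norm_zero]; positivity
  have hS0 : 0 < ‖v‖ := norm_pos_iff.2 hv
  have he1 : ‖(-‖v‖⁻¹) • v‖ = 1 := by
    rw [norm_smul, norm_neg, norm_inv, norm_norm, inv_mul_cancel₀ hS0.ne']
  have hve : ∀ z : V, inner ℝ v z = -‖v‖ * inner ℝ ((-‖v‖⁻¹) • v) z := by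
    intro z
    rw [real_inner_smul_left]
    field_simp
  generalize (-‖v‖⁻¹) • v = e at he1 hve
  -- With `e = -v / ‖v‖`, the smaller of the two bounds carries the term `-‖v‖ max(0, ⟪e, z - y⟫)`,
  -- which on the sphere is at most `-‖v‖ k`. At the centre this costs `‖v‖ R / (16N)` against a
  -- gain of `C R²`.
  obtain ⟨k, hkc, hkh, hkx, hk⟩ := exists_harmonic_barrier hN he1 hR x
  have h4 := hu.le_of_harmonic (Metric.closedBall x R) (isCompact_closedBall x R) hΩ
    (fun z => ((a + C * R ^ 2) + L (z - x)) + (-‖v‖) * k z) (by fun_prop)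
    (fun z _ => (harmonicAt_affine _ L x z).add (hkh z).const_smul) (by
      intro z hz
      rw [frontier_closedBall x hR.ne', mem_sphere_iff_norm] at hz
      have hzR : z ∈ Metric.closedBall x R := by rw [mem_closedBall_iff_norm, hz]
      rcases hk _ hyR z hz with hle | hle
      · refine (h₁ z hzR).trans (EReal.coe_le_coe_iff.2 ?_)
        rw [hz]
        have := mul_nonpos_of_nonneg_of_nonpos hS0.le hle
        linarith
      · refine (h₂ z hzR).trans (EReal.coe_le_coe_iff.2 ?_)
        rw [hz, hve, show z - y = (z - x) - (y - x) by abel, inner_sub_right]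
        have hey : inner ℝ e (y - x) ≤ ‖y - x‖ := by
          have := real_inner_le_norm e (y - x)
          rwa [he1, one_mul] at this
        have := mul_le_mul_of_nonneg_left (hle.trans (sub_le_sub_left hey _)) hS0.le
        linarith) x (Metric.mem_closedBall_self hR.le)
  rw [hx, EReal.coe_le_coe_iff, sub_self, map_zero, hkx] at h4
  have hN0 : (0 : ℝ) < Module.finrank ℝ V := by exact_mod_cast hN
  have h8 : ‖v‖ * R / (16 * Module.finrank ℝ V) ≤ C * R ^ 2 := by
    rw [mul_div_assoc]; linarith
  rw [div_le_iff₀ (by positivity)] at h8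
  refine le_of_mul_le_mul_right (?_ : ‖v‖ * R ≤ _ * R) hR
  linarith

end Touching

/-! ### Lipschitz dependence of slopes, and contact points off a null set. -/

section Touching

variable {V : Type*} [NormedAddCommGroup V] [InnerProductSpace ℝ V] [FiniteDimensional ℝ V]
  {u : V → EReal} {Ω : Set V}

/-- Slopes at contact points depend on the contact points in a Lipschitz way. -/
theorem IsSubharmonicOn.norm_slope_sub_le (hu : IsSubharmonicOn u Ω)
    (hN : 0 < Module.finrank ℝ V) {c x y p q : V} {a b C ρ δ : ℝ} {φ : V → ℝ} (hρ : 0 < ρ)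
    (hΩ : Metric.closedBall c ρ ⊆ Ω) (hC : 0 ≤ C)
    (hφ : ∀ z ∈ Metric.closedBall c ρ, φ z ≤ φ x + fderiv ℝ φ x (z - x) + C * ‖z - x‖ ^ 2)
    (hxc : ‖x - c‖ ≤ ρ / 2) (hyc : ‖y - c‖ ≤ ρ / 2) (hx : u x = (a : EReal))
    (hy : u y = (b : EReal))
    (hxt : ∀ z ∈ Metric.closedBall c ρ,
      u z ≤ ((a + (φ z + inner ℝ p z - (φ x + inner ℝ p x)) : ℝ) : EReal))
    (hyt : ∀ z ∈ Metric.closedBall c ρ,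
      u z ≤ ((b + (φ z + inner ℝ q z - (φ y + inner ℝ q y)) : ℝ) : EReal))
    (hpq : ‖p - q‖ ≤ δ) :
    ‖p - q‖ ≤ (32 * (Module.finrank ℝ V : ℝ) ^ 2 * C + 4 * Module.finrank ℝ V * δ / ρ) * ‖x - y‖ := by
  have hN1 : (1 : ℝ) ≤ Module.finrank ℝ V := by exact_mod_cast hN
  have hδ : 0 ≤ δ := (norm_nonneg _).trans hpq
  have hyball : y ∈ Metric.closedBall c ρ := by
    rw [mem_closedBall_iff_norm]; linarith
  have key : ∀ R : ℝ, 0 < R → R ≤ ρ / 2 → 4 * (Module.finrank ℝ V : ℝ) * ‖x - y‖ ≤ 3 * R →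
      ‖p - q‖ ≤ 16 * Module.finrank ℝ V * C * R := by
    intro R hR hRρ hxy
    have hsub : Metric.closedBall x R ⊆ Metric.closedBall c ρ :=
      Metric.closedBall_subset_closedBall' (by rw [dist_eq_norm]; linarith)
    rw [norm_sub_rev]
    refine hu.norm_slope_le hN (x := x) (y := y) (a := a) (fderiv ℝ φ x + innerSL ℝ p) hC hR
      (by rwa [norm_sub_rev]) (hsub.trans hΩ) hx (fun z hz => ?_) (fun z hz => ?_)
    · refine (hxt z (hsub hz)).trans (EReal.coe_le_coe_iff.2 ?_)
      have := hφ z (hsub hz)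
      simp only [_root_.add_apply, innerSL_apply_apply, inner_sub_right] at this ⊢
      linarith
    · refine (hyt z (hsub hz)).trans (EReal.coe_le_coe_iff.2 ?_)
      have h1 := hφ z (hsub hz)
      -- The first touching evaluated at `y` bounds `b`, so the second majorant is the first plus
      -- `⟪q - p, z - y⟫`.
      have h2 := hxt y hyball
      rw [hy, EReal.coe_le_coe_iff] at h2
      simp only [_root_.add_apply, innerSL_apply_apply, inner_sub_right, inner_sub_left] at h1 ⊢
      linarith
  generalize (Module.finrank ℝ V : ℝ) = N at hN1 key ⊢
  -- For `x = y` arbitrarily small radii force `p = q`; otherwise `R = 2N‖x - y‖` is used if it fits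
  -- in the ball, and if not, the crude bound `δ` suffices.
  rcases (norm_nonneg (x - y)).eq_or_lt with h0 | h0
  · rw [← h0, mul_zero]
    by_contra hneg
    push Not at hneg
    have hD : 0 < 32 * N * C + 1 := by positivity
    have h1 := key (min (ρ / 2) (‖p - q‖ / (32 * N * C + 1))) (by positivity) (min_le_left _ _)
      (by rw [← h0, mul_zero]; positivity)
    have h2 : 16 * N * C * min (ρ / 2) (‖p - q‖ / (32 * N * C + 1)) ≤
        16 * N * C * (‖p - q‖ / (32 * N * C + 1)) :=
      mul_le_mul_of_nonneg_left (min_le_right _ _) (by positivity)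
    have h3 := h1.trans h2
    rw [← mul_div_assoc, le_div_iff₀ hD] at h3
    have : 0 ≤ 16 * N * C * ‖p - q‖ := by positivity
    linarith
  · rcases le_total (2 * N * ‖x - y‖) (ρ / 2) with hle | hle
    · have h1 := key (2 * N * ‖x - y‖) (by positivity) hle (by nlinarith)
      have : 0 ≤ 4 * N * δ / ρ * ‖x - y‖ := by positivity
      linarith
    · have h1 : δ ≤ 4 * N * δ / ρ * ‖x - y‖ := by
        rw [div_mul_eq_mul_div, le_div_iff₀ hρ]
        nlinarith
      have : 0 ≤ 32 * N ^ 2 * C * ‖x - y‖ := by positivity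
      linarith

/-- The maximum of `u - φ` over `A` is attained and negative. The uniform gap keeps contact points
near the centre under small tilts. -/
theorem UpperSemicontinuousOn.exists_pos_forall_le_sub {X : Type*} [TopologicalSpace X]
    {u : X → EReal} {A : Set X} (hA : IsCompact A) (hu : UpperSemicontinuousOn u A) {φ : X → ℝ}
    (hφ : ContinuousOn φ A) (hlt : ∀ z ∈ A, u z < (φ z : EReal)) :
    ∃ δ : ℝ, 0 < δ ∧ ∀ z ∈ A, u z ≤ ((φ z - δ : ℝ) : EReal) := by
  rcases A.eq_empty_or_nonempty with rfl | hne
  · exact ⟨1, one_pos, by simp⟩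
  obtain ⟨x, hxA, hx⟩ := UpperSemicontinuousOn.exists_isMaxOn hne hA (hu.add_coe hφ.neg)
  have hF : ∀ z, ∀ t : ℝ, u z + ((-φ z : ℝ) : EReal) ≤ (t : EReal) ↔
      u z ≤ ((φ z + t : ℝ) : EReal) := by
    intro z t
    induction u z using EReal.rec with
    | bot => simp
    | coe r => norm_cast; constructor <;> intro h <;> linarith
    | top => rw [EReal.top_add_coe]; simp [-EReal.coe_add]
  have hx0 : u x + ((-φ x : ℝ) : EReal) < ((0 : ℝ) : EReal) := by
    have := hlt x hxA
    revert this
    induction u x using EReal.rec with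
    | bot => simp
    | coe r => intro h; norm_cast at h ⊢; linarith
    | top => simp
  obtain ⟨t, ht1, ht2⟩ := EReal.lt_iff_exists_real_btwn.1 hx0
  refine ⟨-t, by simpa using EReal.coe_lt_coe_iff.1 ht2, fun z hz => ?_⟩
  rw [sub_neg_eq_add, ← hF]
  exact (hx hz).trans ht1.le

/-- If a `C²` function touches a subharmonic function from above, up to a strict gap away from the
centre, then a suitable affine perturbation of it touches outside of any given null set. -/
theorem IsSubharmonicOn.exists_touching_notMem [MeasurableSpace V] [BorelSpace V]
    (hu : IsSubharmonicOn u Ω)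
    (hN : 0 < Module.finrank ℝ V) {E U : Set V} (hE : Measure.hausdorffMeasure (Module.finrank ℝ V) E = 0)
    {c : V} {ρ : ℝ} (hρ : 0 < ρ) (hΩ : Metric.closedBall c ρ ⊆ Ω) (hU : IsOpen U)
    (hcU : Metric.closedBall c ρ ⊆ U) {φ : V → ℝ} (hφ : ContDiffOn ℝ 2 φ U)
    (hann : ∀ z ∈ Metric.closedBall c ρ, ρ / 2 ≤ ‖z - c‖ → u z < (φ z : EReal))
    (hc : (φ c : EReal) ≤ u c) :
    ∃ x ∈ Metric.ball c ρ, x ∉ E ∧ ∃ (a : ℝ) (p : V), u x = (a : EReal) ∧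
      ∀ z ∈ Metric.closedBall c ρ,
        u z ≤ ((a + (φ z + inner ℝ p z - (φ x + inner ℝ p x)) : ℝ) : EReal) := by
  by_contra! hcon
  have hB : IsCompact (Metric.closedBall c ρ) := isCompact_closedBall c ρ
  have hφc : ContinuousOn φ (Metric.closedBall c ρ) := hφ.continuousOn.mono hcU
  have husc := hu.upperSemicontinuousOn.mono hΩ
  have hcB : c ∈ Metric.closedBall c ρ := Metric.mem_closedBall_self hρ.le
  obtain ⟨C, hC, htan⟩ := hφ.exists_le_tangent_add_sq hU hcU hB (convex_closedBall c ρ)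
  have hA : IsCompact (Metric.closedBall c ρ ∩ {z | ρ / 2 ≤ ‖z - c‖}) :=
    hB.inter_right (isClosed_le continuous_const (by fun_prop))
  obtain ⟨δ, hδ, hgap⟩ := (husc.mono Set.inter_subset_left).exists_pos_forall_le_sub hA
    (hφc.mono Set.inter_subset_left) (fun z hz => hann z hz.1 hz.2)
  have htouch : ∀ p : V, ∃ x ∈ Metric.closedBall c ρ, ∃ a : ℝ, u x = (a : EReal) ∧
      ∀ z ∈ Metric.closedBall c ρ,
        u z ≤ ((a + (φ z + inner ℝ p z - (φ x + inner ℝ p x)) : ℝ) : EReal) := fun p =>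
    husc.exists_touching hB (fun z hz => hu.lt_top z (hΩ hz)) (ψ := fun z => φ z + inner ℝ p z)
      (by fun_prop) hcB (ne_bot_of_le_ne_bot (EReal.coe_ne_bot _) hc)
  choose x hxB a hxa hxt using htouch
  -- For `‖p‖ < δ / ρ` the tilt varies by less than the gap `δ` between the centre and any point of
  -- the ball.
  have hxc : ∀ p ∈ Metric.ball (0 : V) (δ / ρ), ‖x p - c‖ < ρ / 2 := by
    intro p hp
    by_contra! hge
    have h1 := hgap (x p) ⟨hxB p, hge⟩
    have h2 := hc.trans (hxt p c hcB)
    rw [hxa, EReal.coe_le_coe_iff] at h1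
    rw [EReal.coe_le_coe_iff] at h2
    have h3 : inner ℝ p (c - x p) ≤ ‖p‖ * ‖c - x p‖ := real_inner_le_norm _ _
    rw [mem_ball_zero_iff, lt_div_iff₀ hρ] at hp
    have h4 : ‖c - x p‖ ≤ ρ := by rw [norm_sub_rev]; exact mem_closedBall_iff_norm.1 (hxB p)
    have h5 := mul_le_mul_of_nonneg_left h4 (norm_nonneg p)
    rw [inner_sub_right] at h3
    linarith
  have hxE : ∀ p ∈ Metric.ball (0 : V) (δ / ρ), x p ∈ E := by
    intro p hp
    by_contra hxE
    obtain ⟨z, hz, hlt⟩ := hcon (x p) (mem_ball_iff_norm.2 (by linarith [hxc p hp])) hxE (a p) p (hxa p)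
    exact hlt.not_ge (hxt p z hz)
  set M : ℝ := 32 * (Module.finrank ℝ V : ℝ) ^ 2 * C +
    4 * Module.finrank ℝ V * (2 * (δ / ρ)) / ρ
  have hM : 0 ≤ M := by positivity
  have hanti : AntilipschitzWith ⟨M, hM⟩ (fun p : Metric.ball (0 : V) (δ / ρ) => x p) := by
    refine AntilipschitzWith.of_le_mul_dist fun p q => ?_
    rw [Subtype.dist_eq, dist_eq_norm, dist_eq_norm]
    refine hu.norm_slope_sub_le hN hρ hΩ hC (htan _ (hxB p)) (hxc p p.2).le (hxc q q.2).le
      (hxa p) (hxa q) (hxt p) (hxt q) ?_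
    have h1 := mem_ball_zero_iff.1 p.2
    have h2 := mem_ball_zero_iff.1 q.2
    linarith [norm_sub_le (p : V) q]
  -- If all contact points were in `E`, the ball of slopes, a Lipschitz image of a null set, would
  -- be null.
  have h1 := hanti.le_hausdorffMeasure_image (d := Module.finrank ℝ V) (Nat.cast_nonneg _) Set.univ
  have h2 : Measure.hausdorffMeasure (Module.finrank ℝ V : ℝ)
      ((fun p : Metric.ball (0 : V) (δ / ρ) => x p) '' Set.univ) = 0 :=
    measure_mono_null (by rintro _ ⟨p, -, rfl⟩; exact hxE p p.2) hE
  rw [h2, mul_zero, ← (isometry_subtype_coe).hausdorffMeasure_image (Or.inl (Nat.cast_nonneg _)),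
    Set.image_univ, Subtype.range_coe] at h1
  have := isAddHaarMeasure_hausdorffMeasure (E := V)
  exact (Metric.measure_ball_pos (Measure.hausdorffMeasure (Module.finrank ℝ V : ℝ)) (0 : V)
    (div_pos hδ hρ)).not_ge h1

end Touching

/-! ### Failure of the maximum principle on a line. -/

section Line

variable {X : Type*} [NormedAddCommGroup X] [InnerProductSpace ℝ X]

/-- If the comparison of `v` with `h` fails on `K`, then an affine perturbation of `h` touches `v`
strictly from above at an interior point of `K`. -/
theorem UpperSemicontinuousOn.exists_strict_touching {K : Set X} (hK : IsCompact K) {v : X → EReal}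
    (hv : UpperSemicontinuousOn v K) (hlt : ∀ τ ∈ K, v τ < ⊤) {h : X → ℝ} (hh : ContinuousOn h K)
    (hfr : ∀ τ ∈ frontier K, v τ ≤ (h τ : EReal)) {τ₀ : X} (hτ₀ : τ₀ ∈ K)
    (hlt₀ : (h τ₀ : EReal) < v τ₀) :
    ∃ τ₁ ∈ interior K, ∃ (ε b : ℝ) (L : X →L[ℝ] ℝ), 0 < ε ∧ v τ₁ = ((h τ₁ + b : ℝ) : EReal) ∧
      ∀ τ ∈ K, v τ ≤ ((h τ + (b + L (τ - τ₁)) - 2 * ε * ‖τ - τ₁‖ ^ 2 : ℝ) : EReal) := by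
  obtain ⟨D, hD⟩ := hK.isBounded.subset_closedBall τ₀
  have hbot : v τ₀ ≠ ⊥ := ne_bot_of_gt hlt₀
  obtain ⟨m, hm⟩ : ∃ m : ℝ, v τ₀ = (m : EReal) :=
    ⟨_, (EReal.coe_toReal (hlt τ₀ hτ₀).ne hbot).symm⟩
  rw [hm, EReal.coe_lt_coe_iff] at hlt₀
  -- Chosen so that `2εD² < m - h τ₀`: the quadratic term cannot use up the excess of `v` over `h`
  -- at `τ₀`, which keeps the contact point off the frontier.
  set ε : ℝ := (m - h τ₀) / (2 * (D ^ 2 + 1)) with hε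
  have hD1 : 0 < D ^ 2 + 1 := by positivity
  have hε0 : 0 < ε := div_pos (by linarith) (by positivity)
  have hεD : 2 * ε * (D ^ 2 + 1) = m - h τ₀ := by rw [hε]; field_simp
  obtain ⟨τ₁, hτ₁, a, ha, hτ⟩ := hv.exists_touching hK hlt
    (ψ := fun τ => h τ - 2 * ε * ‖τ - τ₀‖ ^ 2) (by fun_prop) hτ₀ hbot
  have hint : τ₁ ∈ interior K := by
    by_contra hint
    have h1 := hfr τ₁ ⟨subset_closure hτ₁, hint⟩
    have h2 := hτ τ₀ hτ₀
    rw [ha, EReal.coe_le_coe_iff] at h1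
    rw [hm, EReal.coe_le_coe_iff, sub_self, norm_zero] at h2
    have h3 : ‖τ₁ - τ₀‖ ≤ D := mem_closedBall_iff_norm.1 (hD hτ₁)
    have h4 : ‖τ₁ - τ₀‖ ^ 2 ≤ D ^ 2 := pow_le_pow_left₀ (norm_nonneg _) h3 2
    nlinarith
  -- Recentring the square from `τ₀` to `τ₁` costs only an affine term, which is harmonic.
  refine ⟨τ₁, hint, ε, a - h τ₁, (-(4 * ε)) • innerSL ℝ (τ₁ - τ₀), hε0, by rw [ha]; simp,
    fun τ hτK => (hτ τ hτK).trans (EReal.coe_le_coe_iff.2 (le_of_eq ?_))⟩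
  have h5 : ‖τ - τ₀‖ ^ 2 =
      ‖τ - τ₁‖ ^ 2 + 2 * inner ℝ (τ₁ - τ₀) (τ - τ₁) + ‖τ₁ - τ₀‖ ^ 2 := by
    rw [show τ - τ₀ = (τ - τ₁) + (τ₁ - τ₀) by abel, norm_add_sq_real, real_inner_comm]
  simp only [h5, _root_.smul_apply, innerSL_apply_apply, smul_eq_mul]
  ring

/-- A harmonic function of one complex variable has no strict local minimum of quadratic type. -/
theorem not_harmonic_of_strict_min {h : ℂ → ℝ} {c : ℂ} {η ε : ℝ} (hη : 0 < η) (hε : 0 < ε)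
    (hh : InnerProductSpace.HarmonicOnNhd h (Metric.ball c η))
    (hmin : ∀ τ ∈ Metric.ball c η, h c + ε * ‖τ - c‖ ^ 2 ≤ h τ) : False := by
  have hη2 : |η / 2| = η / 2 := abs_of_pos (by positivity)
  have hsub : Metric.closedBall c |η / 2| ⊆ Metric.ball c η := by
    rw [hη2]; exact Metric.closedBall_subset_ball (by linarith)
  have h1 := (hh.neg.mono hsub).circleAverage_eq
  have h2 : Real.circleAverage (-h) c (η / 2) ≤ -h c - ε * (η / 2) ^ 2 := by
    refine Real.circleAverage_mono_on_of_le_circle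
      ((hh.neg.mono hsub).continuousOn.mono Metric.sphere_subset_closedBall).circleIntegrable' ?_
    intro τ hτ
    have h3 := hmin τ (hsub (Metric.sphere_subset_closedBall hτ))
    rw [mem_sphere_iff_norm.1 hτ, hη2] at h3
    simp only [Pi.neg_apply]
    linarith
  rw [h1] at h2
  have : 0 < ε * (η / 2) ^ 2 := by positivity
  simp only [Pi.neg_apply] at h2
  linarith

end Line

/-! ### Extension off the line by penalization. -/

section Penalization

/-- Penalizing the directions transversal to a closed set makes a strict inequality on that set
valid on a whole compact set. -/
theorem UpperSemicontinuousOn.exists_penalization {X : Type*} [TopologicalSpace X] {A : Set X}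
    (hA : IsCompact A) {u : X → EReal} (hu : UpperSemicontinuousOn u A) (hlt : ∀ z ∈ A, u z < ⊤)
    {f g : X → ℝ} (hf : ContinuousOn f A) (hg : ContinuousOn g A) (hg0 : ∀ z ∈ A, 0 ≤ g z)
    (hfu : ∀ z ∈ A, g z = 0 → u z < (f z : EReal)) :
    ∃ k : ℝ, ∀ z ∈ A, u z < ((f z + k * g z : ℝ) : EReal) := by
  suffices H : ∃ k : ℝ, ∀ z ∈ A, z ∈ A → u z < ((f z + k * g z : ℝ) : EReal) from
    H.imp fun k hk z hz => hk z hz hz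
  refine hA.induction_on (p := fun S => ∃ k : ℝ, ∀ z ∈ S, z ∈ A → u z < ((f z + k * g z : ℝ) : EReal))
    ⟨0, by simp⟩ (fun s t hst ⟨k, hk⟩ => ⟨k, fun z hz => hk z (hst hz)⟩) ?_ ?_
  · rintro s t ⟨k, hk⟩ ⟨l, hl⟩
    refine ⟨max k l, fun z hz hzA => ?_⟩
    rcases hz with hz | hz
    · exact (hk z hz hzA).trans_le (EReal.coe_le_coe_iff.2 (add_le_add_right
        (mul_le_mul_of_nonneg_right (le_max_left _ _) (hg0 z hzA)) _))
    · exact (hl z hz hzA).trans_le (EReal.coe_le_coe_iff.2 (add_le_add_right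
        (mul_le_mul_of_nonneg_right (le_max_right _ _) (hg0 z hzA)) _))
  · intro x hx
    obtain ⟨k, hk⟩ : ∃ k : ℝ, u x < ((f x + k * g x : ℝ) : EReal) := by
      rcases (hg0 x hx).eq_or_lt with h0 | h0
      · exact ⟨0, by simpa using hfu x hx h0.symm⟩
      · obtain ⟨m, hm, -⟩ := EReal.lt_iff_exists_real_btwn.1 (hlt x hx)
        refine ⟨(m - f x) / g x, ?_⟩
        rwa [div_mul_cancel₀ _ h0.ne', add_sub_cancel]
    obtain ⟨t, ht1, ht2⟩ := EReal.lt_iff_exists_real_btwn.1 hk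
    have h1 : ∀ᶠ z in 𝓝[A] x, u z < (t : EReal) := hu x hx _ ht1
    have h2 : ∀ᶠ z in 𝓝[A] x, t < f z + k * g z :=
      (hf.add (continuousOn_const.mul hg) x hx).eventually_const_lt (EReal.coe_lt_coe_iff.1 ht2)
    refine ⟨{z | u z < ((f z + k * g z : ℝ) : EReal)}, ?_, k, fun z hz _ => hz⟩
    filter_upwards [h1, h2] with z hz1 hz2
    exact hz1.trans (EReal.coe_lt_coe_iff.2 hz2)

end Penalization

/-! ### Removability of closed null sets. -/

section Plurisubharmonic

variable {n : ℕ} {u : EuclideanSpace ℂ (Fin n) → EReal} {Ω E : Set (EuclideanSpace ℂ (Fin n))}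

/-- On a complex line along which `u` is subharmonic, `u` cannot be touched from above by a function
that is, up to harmonic terms, a negative multiple of the squared modulus. -/
theorem IsPlurisubharmonicOn.false_of_touching_line (hu : IsPlurisubharmonicOn u Ω)
    {b w p : EuclideanSpace ℂ (Fin n)} {g : ℂ → ℝ} {σ τ₁ : ℂ} {a r ε : ℝ} (hr : 0 < r) (hε : 0 < ε)
    (hsub : ∀ τ ∈ Metric.closedBall σ r, b + τ • w ∈ Ω)
    (hg : InnerProductSpace.HarmonicOnNhd g (Metric.closedBall σ r)) (ha : u (b + σ • w) = (a : EReal))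
    (hle : ∀ τ ∈ Metric.closedBall σ r, u (b + τ • w) ≤
      ((a + (g τ - ε * ‖τ - τ₁‖ ^ 2 + inner ℝ p (b + τ • w) -
        (g σ - ε * ‖σ - τ₁‖ ^ 2 + inner ℝ p (b + σ • w))) : ℝ) : EReal)) : False := by
  obtain ⟨L, hL⟩ : ∃ L : ℂ →L[ℝ] ℝ, ∀ ζ : ℂ,
      L ζ = -(2 * ε) * inner ℝ (σ - τ₁) ζ + inner ℝ p (ζ • w) := by
    refine ⟨(-(2 * ε)) • innerSL ℝ (σ - τ₁) + (innerSL ℝ p).comp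
      (((1 : ℂ →L[ℂ] ℂ).smulRight w).restrictScalars ℝ), fun ζ => ?_⟩
    rfl
  have h1 := (hu.subharmonicOn_line b w).le_of_harmonic (Metric.closedBall σ r)
    (isCompact_closedBall σ r) hsub (g + fun τ => (a - g σ - ε * r ^ 2) + L (τ - σ))
    (hg.continuousOn.add (by fun_prop))
    (fun τ hτ => (hg τ (interior_subset hτ)).add (harmonicAt_affine _ L σ τ)) (by
      intro τ hτ
      rw [frontier_closedBall σ hr.ne'] at hτ
      refine (hle τ (Metric.sphere_subset_closedBall hτ)).trans
        (EReal.coe_le_coe_iff.2 (le_of_eq ?_))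
      -- On the circle the square is affine in `τ`, so the majorant has harmonic boundary values;
      -- their harmonic extension falls short by `ε r²` at the centre.
      have h2 : ‖τ - τ₁‖ ^ 2 = r ^ 2 + 2 * inner ℝ (σ - τ₁) (τ - σ) + ‖σ - τ₁‖ ^ 2 := by
        rw [show τ - τ₁ = (τ - σ) + (σ - τ₁) by ring, norm_add_sq_real, real_inner_comm,
          mem_sphere_iff_norm.1 hτ]
      rw [h2, inner_add_right, inner_add_right]
      simp only [Pi.add_apply, hL, sub_smul, inner_sub_right]
      ring) σ (Metric.mem_closedBall_self hr.le)
  rw [ha, EReal.coe_le_coe_iff] at h1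
  simp only [Pi.add_apply, sub_self, map_zero] at h1
  have : 0 < ε * r ^ 2 := by positivity
  linarith

/-- A function that is subharmonic on `Ω` and plurisubharmonic off a closed null set cannot be
touched from above along a complex line by a strictly superharmonic function. -/
theorem IsSubharmonicOn.false_of_strict_touching (hu : IsSubharmonicOn u Ω)
    (hpsh : IsPlurisubharmonicOn u (Ω \ E)) (hΩ : IsOpen Ω) (hΩE : IsOpen (Ω \ E))
    (hE : volume E = 0) {a w : EuclideanSpace ℂ (Fin n)} {τ₁ : ℂ} {h : ℂ → ℝ} {η ε : ℝ}
    (hη : 0 < η) (hε : 0 < ε) (hΩ₁ : a + τ₁ • w ∈ Ω)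
    (hh : InnerProductSpace.HarmonicOnNhd h (Metric.ball τ₁ η))
    (heq : u (a + τ₁ • w) = (h τ₁ : EReal))
    (hle : ∀ τ ∈ Metric.ball τ₁ η,
      u (a + τ • w) ≤ ((h τ - 2 * ε * ‖τ - τ₁‖ ^ 2 : ℝ) : EReal)) : False := by
  rcases eq_or_ne w 0 with rfl | hw
  -- The line degenerates to a point, so `u` is constant along it and the mean value property of `h`
  -- already fails.
  · refine not_harmonic_of_strict_min hη (by positivity : 0 < 2 * ε) hh fun τ hτ => ?_
    have h1 := hle τ hτ
    rw [smul_zero] at h1 heq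
    rw [heq, EReal.coe_le_coe_iff] at h1
    linarith
  obtain ⟨π, hπ⟩ := SeparatingDual.exists_eq_one (R := ℂ) hw
  have hπ2 : ContDiff ℝ 2 π := (π.restrictScalars ℝ).contDiff
  have hN : 0 < Module.finrank ℝ (EuclideanSpace ℂ (Fin n)) := by
    have : Nontrivial (EuclideanSpace ℂ (Fin n)) := ⟨w, 0, hw⟩
    exact Module.finrank_pos
  have hμE : Measure.hausdorffMeasure (Module.finrank ℝ (EuclideanSpace ℂ (Fin n))) E = 0 := by
    have := isAddHaarMeasure_hausdorffMeasure (E := EuclideanSpace ℂ (Fin n))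
    exact Measure.absolutelyContinuous_isAddHaarMeasure _ volume hE
  generalize hz₁ : a + τ₁ • w = z₁ at hΩ₁ heq
  -- the complex coordinate along the line, and the transversal part
  obtain ⟨G, hG⟩ : ∃ G : EuclideanSpace ℂ (Fin n) → ℂ, ∀ z, G z = τ₁ + π (z - z₁) := ⟨_, fun _ => rfl⟩
  obtain ⟨P, hP⟩ : ∃ P : EuclideanSpace ℂ (Fin n) → EuclideanSpace ℂ (Fin n),
      ∀ z, P z = (z - z₁) - (G z - τ₁) • w := ⟨_, fun _ => rfl⟩
  have hG2 : ContDiff ℝ 2 G := by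
    rw [funext hG]
    exact contDiff_const.add (hπ2.comp (contDiff_id.sub contDiff_const))
  have hP2 : ContDiff ℝ 2 P := by
    rw [funext hP]
    exact (contDiff_id.sub contDiff_const).sub ((hG2.sub contDiff_const).smul contDiff_const)
  have hGz₁ : G z₁ = τ₁ := by rw [hG, sub_self, map_zero, add_zero]
  have hPz₁ : P z₁ = 0 := by rw [hP, hGz₁]; simp
  set U : Set (EuclideanSpace ℂ (Fin n)) := Ω ∩ G ⁻¹' Metric.ball τ₁ η
  have hU : IsOpen U := hΩ.inter (Metric.isOpen_ball.preimage hG2.continuous)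
  have hz₁U : z₁ ∈ U := ⟨hΩ₁, by rw [Set.mem_preimage, hGz₁]; exact Metric.mem_ball_self hη⟩
  obtain ⟨ρ, hρ, hρU⟩ := Metric.nhds_basis_closedBall.mem_iff.1 (hU.mem_nhds hz₁U)
  have hhG : ContDiffOn ℝ 2 (fun z => h (G z)) U :=
    hh.contDiffOn.comp hG2.contDiffOn fun z hz => hz.2
  -- Only half of `2ε` is kept, for strict superharmonicity; the other half gives the strict gap on
  -- the line away from `z₁`.
  have hf : ContDiffOn ℝ 2 (fun z => h (G z) - ε * ‖G z - τ₁‖ ^ 2) U :=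
    hhG.sub (contDiffOn_const.mul ((hG2.sub contDiff_const).norm_sq ℝ).contDiffOn)
  have hPn : ContDiff ℝ 2 (fun z => ‖P z‖ ^ 2) := hP2.norm_sq ℝ
  set A : Set (EuclideanSpace ℂ (Fin n)) := Metric.closedBall z₁ ρ ∩ {z | ρ / 2 ≤ ‖z - z₁‖}
  have hA : IsCompact A :=
    (isCompact_closedBall z₁ ρ).inter_right (isClosed_le continuous_const (by fun_prop))
  have hAU : A ⊆ U := Set.inter_subset_left.trans hρU
  obtain ⟨k, hk⟩ := (hu.upperSemicontinuousOn.mono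
    (hAU.trans Set.inter_subset_left)).exists_penalization hA
    (fun z hz => hu.lt_top z (hAU hz).1) (hf.continuousOn.mono hAU) hPn.continuous.continuousOn
    (fun z _ => sq_nonneg _) (by
      intro z hz hPz
      have h1 : z - z₁ = (G z - τ₁) • w := by
        rw [← sub_eq_zero, ← hP]
        exact norm_eq_zero.1 (pow_eq_zero_iff two_ne_zero |>.1 hPz)
      have h2 : z = a + G z • w := by
        rw [sub_eq_iff_eq_add, ← hz₁, sub_smul] at h1
        refine h1.trans ?_
        abel
      have h3 := hle (G z) (hAU hz).2
      rw [← h2] at h3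
      refine h3.trans_lt (EReal.coe_lt_coe_iff.2 ?_)
      have h4 : G z - τ₁ ≠ 0 := by
        intro h0
        have h5 : ρ / 2 ≤ ‖z - z₁‖ := hz.2
        rw [h1, h0, zero_smul, norm_zero] at h5
        linarith
      have h5 : 0 < ‖G z - τ₁‖ ^ 2 := by have := norm_pos_iff.2 h4; positivity
      nlinarith)
  obtain ⟨x, hxρ, hxE, c, p, hxc, hx⟩ := hu.exists_touching_notMem hN hμE hρ
    (hρU.trans Set.inter_subset_left) hU hρU
    (φ := fun z => h (G z) - ε * ‖G z - τ₁‖ ^ 2 + k * ‖P z‖ ^ 2)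
    (hf.add (contDiffOn_const.mul hPn.contDiffOn)) (fun z hz hz2 => hk z ⟨hz, hz2⟩)
    (by rw [heq, hGz₁, hPz₁]; simp)
  -- the line through the contact point
  have hline : x - G x • w + G x • w = x := sub_add_cancel _ _
  have hGl : ∀ τ : ℂ, G (x - G x • w + τ • w) = τ := by
    intro τ
    rw [hG, show x - G x • w + τ • w - z₁ = (x - z₁) + (τ - G x) • w by rw [sub_smul]; abel,
      map_add, map_smul, hπ, hG x, smul_eq_mul]
    ring
  have hPl : ∀ τ : ℂ, P (x - G x • w + τ • w) = P x := by
    intro τ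
    rw [hP, hP, hGl, sub_smul, sub_smul]
    abel
  have hopen : IsOpen ((fun τ : ℂ => x - G x • w + τ • w) ⁻¹' ((Ω \ E) ∩ Metric.ball z₁ ρ)) :=
    (hΩE.inter Metric.isOpen_ball).preimage (by fun_prop)
  obtain ⟨r, hr, hrsub⟩ := Metric.nhds_basis_closedBall.mem_iff.1 (hopen.mem_nhds
    (show G x ∈ _ by
      rw [Set.mem_preimage, hline]
      exact ⟨⟨(hρU (Metric.ball_subset_closedBall hxρ)).1, hxE⟩, hxρ⟩))
  refine hpsh.false_of_touching_line (b := x - G x • w) (w := w) (p := p) (g := h) (σ := G x)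
    (τ₁ := τ₁) (a := c) hr hε (fun τ hτ => (hrsub hτ).1) (fun τ hτ => hh τ ?_)
    (by rw [hline, hxc]) (fun τ hτ => ?_)
  · have h1 := (hρU (Metric.ball_subset_closedBall (hrsub hτ).2)).2
    rwa [Set.mem_preimage, hGl] at h1
  · refine (hx _ (Metric.ball_subset_closedBall (hrsub hτ).2)).trans
      (EReal.coe_le_coe_iff.2 (le_of_eq ?_))
    rw [hGl, hPl, hline]
    ring

/-- Closed null sets are removable for plurisubharmonicity of subharmonic functions. -/
theorem IsSubharmonicOn.isPlurisubharmonicOn_of_diff (hu : IsSubharmonicOn u Ω)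
    (hpsh : IsPlurisubharmonicOn u (Ω \ E)) (hΩ : IsOpen Ω) (hΩE : IsOpen (Ω \ E))
    (hE : volume E = 0) : IsPlurisubharmonicOn u Ω := by
  refine ⟨hu.lt_top, hu.upperSemicontinuousOn, fun a w => ?_⟩
  have husc : UpperSemicontinuousOn (fun τ : ℂ => u (a + τ • w)) {τ : ℂ | a + τ • w ∈ Ω} :=
    hu.upperSemicontinuousOn.comp (by fun_prop) fun _ hτ => hτ
  refine ⟨fun τ hτ => hu.lt_top _ hτ, husc, fun K hK hKs h hhc hh hfr τ₀ hτ₀ => ?_⟩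
  by_contra! hlt
  obtain ⟨τ₁, hτ₁, ε, b, L, hε, heq, hle⟩ := (husc.mono hKs).exists_strict_touching hK
    (fun τ hτ => hu.lt_top _ (hKs hτ)) hhc hfr hτ₀ hlt
  obtain ⟨η, hη, hηK⟩ := Metric.isOpen_iff.1 isOpen_interior τ₁ hτ₁
  refine hu.false_of_strict_touching hpsh hΩ hΩE hE (a := a) (w := w) (τ₁ := τ₁)
    (h := h + fun τ => b + L (τ - τ₁)) hη hε (hKs (interior_subset hτ₁))
    (fun τ hτ => (hh τ (hηK hτ)).add (harmonicAt_affine b L τ₁ τ)) (by simpa using heq)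
    (fun τ hτ => hle τ (interior_subset (hηK hτ)))

/-- A set of locally finite Hausdorff measure of codimension one is a null set. -/
theorem volume_eq_zero_of_locally_hausdorffMeasure_lt_top
    (h : ∀ z ∈ E, ∃ U ∈ 𝓝 z, Measure.hausdorffMeasure (2 * (n : ℝ) - 1) (E ∩ U) < ∞) :
    volume E = 0 := by
  have hd : (Module.finrank ℝ (EuclideanSpace ℂ (Fin n)) : ℝ) = 2 * n := by
    rw [finrank_real_of_complex, finrank_euclideanSpace_fin]; push_cast; ring
  refine measure_null_of_locally_null E fun z hz => ?_
  obtain ⟨U, hU, hfin⟩ := h z hz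
  refine ⟨E ∩ U, Filter.inter_mem self_mem_nhdsWithin (mem_nhdsWithin_of_mem_nhds hU), ?_⟩
  have := isAddHaarMeasure_hausdorffMeasure (E := EuclideanSpace ℂ (Fin n))
  refine Measure.absolutelyContinuous_isAddHaarMeasure volume
    (Measure.hausdorffMeasure (Module.finrank ℝ (EuclideanSpace ℂ (Fin n)) : ℝ)) ?_
  rw [hd]
  exact (Measure.hausdorffMeasure_zero_or_top (by linarith : 2 * (n : ℝ) - 1 < 2 * n)
    (E ∩ U)).resolve_right hfin.ne

end Plurisubharmonic

theorem mainTheorem1 (n : ℕ) (Ω E : Set (EuclideanSpace ℂ (Fin n)))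
    (hΩ : IsOpen Ω) (hΩc : IsConnected Ω) (hEΩ : E ⊆ Ω)
    (hE : IsClosed ((fun z : Ω => (z : EuclideanSpace ℂ (Fin n))) ⁻¹' E)) :
    (volume E = 0 →
      ∀ u : EuclideanSpace ℂ (Fin n) → EReal,
        IsSubharmonicOn u Ω → IsPlurisubharmonicOn u (Ω \ E) → IsPlurisubharmonicOn u Ω) ∧
    ((∀ z ∈ Ω, ∃ U ∈ 𝓝 z, Measure.hausdorffMeasure (2 * (n : ℝ) - 1) (E ∩ U) < ∞) →
      ∀ u : EuclideanSpace ℂ (Fin n) → EReal,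
        IsSubharmonicOn u Ω → IsPlurisubharmonicOn u (Ω \ E) → IsPlurisubharmonicOn u Ω) := by
  have hΩE : IsOpen (Ω \ E) := by
    have h1 := hΩ.isOpenMap_subtype_val _ hE.isOpen_compl
    rwa [← Set.preimage_compl, Subtype.image_preimage_coe, ← Set.sdiff_eq] at h1
  exact ⟨fun hvol u hu hpsh => hu.isPlurisubharmonicOn_of_diff hpsh hΩ hΩE hvol,
    fun hloc u hu hpsh => hu.isPlurisubharmonicOn_of_diff hpsh hΩ hΩE
      (volume_eq_zero_of_locally_hausdorffMeasure_lt_top fun z hz => hloc z (hEΩ hz))⟩
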